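/- Let $\mathbb F=\mathbb F_q$ be a finite field with $q=p^s$ elements, $p$ prime. Vectors are row vectors, and a matrix $M$ acts by $u\mapsto uM$. **Codes.** A matrix $G\in\mathbb F[D]^{k\times n}$ is *basic* if $G\tilde G=I_k$ for some $\tilde G\in\mathbb F[D]^{n\times k}$. For such $G$, the module $\mathcal C=\operatorname{im}G=\{uG: u\in\mathbb F[D]^k\}$ is a convolutional code of dimension $k$, whose degree $\delta$ is the maximal degree of the $k$-minors of $G$. The matrix $G$ is a *minimal encoder* of $\mathcal C$ if moreover $\sum_{i=1}^k\delta_i=\delta$, where $\delta_i=\deg g_i$ is the maximal degree of an entry of the $i$-th row $g_i=\sum_{\nu=0}^{\delta_i}g_{i,\nu}D^\nu$, $g_{i,\nu}\in\mathbb F^n$. The dual code is $\widehat{\mathcal C}=\{w\in\mathbb F[D]^n: wv^{\mathsf T}=0\text{ for all }v\in\mathcal C\}$. **Controller canonical form.** The CCF of a minimal encoder $G$ is the quadruple $(A,B,C,E)\in\mathbb F^{\delta\times\delta}\times\mathbb F^{k\times\delta}\times\mathbb F^{\delta\times n}\times\mathbb F^{k\times n}$ defined as follows. The $\delta$ state coordinates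 are divided into consecutive blocks of sizes $\delta_1,\dots,\delta_k$ (a block may be empty). $A$ is block diagonal, each block having ones on the superdiagonal and zeros elsewhere. The $i$-th row of $B$ is the unit vector at the first coordinate of the $i$-th block if $\delta_i>0$, and $0$ if $\delta_i=0$. The rows of $C$ in the $i$-th block are $g_{i,1},\dots,g_{i,\delta_i}$. The rows of $E$ are $g_{1,0},\dots,g_{k,0}$. **Weight adjacency matrix.** For $S\subseteq\mathbb F^n$ let $\mathrm{we}(S)=\sum_{j=0}^n\#\{a\in S:\mathrm{wt}(a)=j\}\,W^j\in\mathbb C[W]$, where $\mathrm{wt}$ is the Hamming weight. The WAM of $G$ is the matrix $\Lambda\in\mathbb C[W]^{q^\delta\times q^\delta}$, indexed by $\mathbb F^\delta\times\mathbb F^\delta$, with entries $$\Lambda_{X,Y}=\mathrm{we}\big(\{XC+uE: u\in\mathbb F^k,\ Y=XA+uB\}\big).$$ For $P\in\mathrm{GL}_\delta(\mathbb F)$ let $\mathcal P(P)$ be the permutation matrix with $\mathcal P(P)_{X,Y}=1$ if $Y=XP$ and $0$ otherwise. The generalized WAM is $[\Lambda]=\{\mathcal P(P)\Lambda\mathcal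 P(P)^{-1}: P\in\mathrm{GL}_\delta(\mathbb F)\}$. **MacWilliams transformations.** For $f\in\mathbb C[W]$ of degree at most $n$ put $\mathbf H(f)(W)=(1+(q-1)W)^n f\big(\tfrac{1-W}{1+(q-1)W}\big)$; on matrices, $\mathbf H$ acts entrywise. Let $\zeta\in\mathbb C$ be any primitive $p$-th root of unity, $\tau:\mathbb F_q\to\mathbb F_p$, $\tau(a)=\sum_{i=0}^{s-1}a^{p^i}$, and $$\mathcal H=q^{-\delta/2}\big(\zeta^{\tau(XY^{\mathsf T})}\big)_{X,Y\in\mathbb F^\delta}.$$ **Theorem.** Let $\mathcal C\subseteq\mathbb F[D]^n$ be a convolutional code of dimension $k$ and degree $\delta$ with minimal encoder $G\in\mathbb F[D]^{k\times n}$, and let $\widehat G\in\mathbb F[D]^{(n-k)\times n}$ be a minimal encoder of $\widehat{\mathcal C}$. Then $\widehat{\mathcal C}$ has degree $\delta$ as well. Let $(A,B,C,E)$, $(\widehat A,\widehat B,\widehat C,\widehat E)$ be the CCFs and $\Lambda$, $\widehat\Lambda$ the WAMs of $G$ and $\widehat G$. Put $S_0=B^{\mathsf T}E$ and $S_i=B^{\mathsf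 T}BA^{i-1}C$ for $i\ge1$, define $\widehat S_i$ in the same way from $(\widehat A,\widehat B,\widehat C,\widehat E)$, and let $$N=\sum_{m\ge2}\sum_{i=1}^{m-1}\sum_{j=0}^{i-1}(\widehat A^{\mathsf T})^{i-1}\widehat S_jS_{m-j}^{\mathsf T}A^{m-(i+1)},\qquad P=\widehat CE^{\mathsf T}B-NA$$ (the sum is finite: $A^\delta=\widehat A^\delta=0$, so the terms with $m>2\delta$ vanish). Then $P\in\mathrm{GL}_\delta(\mathbb F)$ and $$\widehat\Lambda_{X,Y}=q^{-k}\,\mathbf H\big((\mathcal H\Lambda^{\mathsf T}\mathcal H^{-1})_{XP,YP}\big)\quad\text{for all }X,Y\in\mathbb F^\delta.$$ Consequently, $$[\widehat\Lambda]=q^{-k}\,\mathbf H\big(\mathcal H[\Lambda]^{\mathsf T}\mathcal H^{-1}\big):=\{q^{-k}\,\mathbf H(\mathcal HM^{\mathsf T}\mathcal H^{-1}): M\in[\Lambda]\},$$ and in particular $q^{-k}\,\mathbf H(\mathcal H\Lambda^{\mathsf T}\mathcal H^{-1})\in[\widehat\Lambda]$. -/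

import Mathlib

open Polynomial Matrix

namespace ConvCode

/-! ### Convolutional codes and their minimal encoders

Vectors are row vectors; a matrix `M` acts on them from the right, `u ↦ u ᵥ* M`. -/

section Codes

variable {F : Type*} [Field F] {k n : ℕ}

/-- The submodule `im G = {u G | u ∈ F[D]^k}` of `F[D]^n`. -/
noncomputable def rowImage (G : Matrix (Fin k) (Fin n) F[X]) : Submodule F[X] (Fin n → F[X]) :=
  LinearMap.range G.vecMulLinear

/-- `G` is basic: it has a polynomial right inverse. -/
def IsBasic (G : Matrix (Fin k) (Fin n) F[X]) : Prop :=
  ∃ G' : Matrix (Fin n) (Fin k) F[X], G * G' = 1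

/-- The degree `deg g_i` of the `i`-th row of `G`: the largest degree of an entry. -/
noncomputable def rowDegree (G : Matrix (Fin k) (Fin n) F[X]) (i : Fin k) : ℕ :=
  Finset.univ.sup fun j => (G i j).natDegree

/-- The largest degree of a `k`-minor of `G`. The columns of the minor are selected by an injection
`Fin k ↪ Fin n`; their order only changes the sign of the minor. -/
noncomputable def maxMinorDegree (G : Matrix (Fin k) (Fin n) F[X]) : ℕ :=
  Finset.univ.sup fun s : Fin k ↪ Fin n => (G.submatrix id s).det.natDegree

/-- `G` is a minimal encoder of the `k`-dimensional code `𝒞 ⊆ F[D]^n` of degree `δ`. -/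
structure IsMinimalEncoder (G : Matrix (Fin k) (Fin n) F[X])
    (𝒞 : Submodule F[X] (Fin n → F[X])) (δ : ℕ) : Prop where
  basic : IsBasic G
  image : rowImage G = 𝒞
  degree : maxMinorDegree G = δ
  minimal : ∑ i, rowDegree G i = δ

/-- The module-theoretic dual `{w ∈ F[D]^n | w vᵀ = 0 for all v ∈ 𝒞}`. -/
def dualCode (𝒞 : Submodule F[X] (Fin n → F[X])) : Submodule F[X] (Fin n → F[X]) where
  carrier := {w | ∀ v ∈ 𝒞, w ⬝ᵥ v = 0}
  zero_mem' := fun v _ => zero_dotProduct v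
  add_mem' := fun {a b} ha hb v hv => by
    simp only [Set.mem_ofPred_eq] at ha hb
    rw [add_dotProduct, ha v hv, hb v hv, add_zero]
  smul_mem' := fun c a ha v hv => by
    simp only [Set.mem_ofPred_eq] at ha
    rw [smul_dotProduct, ha v hv, smul_zero]

end Codes

/-! ### The controller canonical form -/

/-- A quadruple of matrices `(A, B, C, E)` describing the state space system
`x_{t+1} = x_t A + u_t B`, `v_t = x_t C + u_t E`. -/
structure StateSpace (F : Type*) (δ k n : ℕ) where
  A : Matrix (Fin δ) (Fin δ) F
  B : Matrix (Fin k) (Fin δ) F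
  C : Matrix (Fin δ) (Fin n) F
  E : Matrix (Fin k) (Fin n) F

section CCF

variable {F : Type*} [Field F] {δ k n : ℕ}

/-- The position, among the `δ = ∑ d i` state coordinates, of the `ν`-th coordinate of the `i`-th
block; the blocks have sizes `d 0, d 1, …` and follow one another. -/
def blockEquiv {d : Fin k → ℕ} (hd : ∑ i, d i = δ) : (Σ i : Fin k, Fin (d i)) ≃ Fin δ :=
  finSigmaFinEquiv.trans (finCongr hd)

/-- The controller canonical form of `G` with rows `g_i = ∑ g_{i,ν} D^ν` of degrees `δ_i`.
`A` is block diagonal, its `i`-th block having ones on the superdiagonal and zeros elsewhere;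
the `i`-th row of `B` is the first unit vector in the `i`-th block; the `i`-th block of `C` has the
rows `g_{i,1}, …, g_{i,δ_i}`; and `E = G(0)`. A row of degree zero contributes an empty block to
`A` and `C` and a zero row to `B`. -/
noncomputable def ccf (G : Matrix (Fin k) (Fin n) F[X]) (hG : ∑ i, rowDegree G i = δ) :
    StateSpace F δ k n where
  A := Matrix.reindex (blockEquiv hG) (blockEquiv hG)
    (Matrix.blockDiagonal' fun i : Fin k =>
      (Matrix.of fun s t => if (t : ℕ) = (s : ℕ) + 1 then 1 else 0 :
        Matrix (Fin (rowDegree G i)) (Fin (rowDegree G i)) F))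
  B := Matrix.reindex (Equiv.refl _) (blockEquiv hG)
    (Matrix.of fun (i : Fin k) (s : Σ i : Fin k, Fin (rowDegree G i)) =>
      if s.1 = i ∧ (s.2 : ℕ) = 0 then 1 else 0)
  C := Matrix.reindex (blockEquiv hG) (Equiv.refl _)
    (Matrix.of fun (s : Σ i : Fin k, Fin (rowDegree G i)) (j : Fin n) =>
      (G s.1 j).coeff ((s.2 : ℕ) + 1))
  E := Matrix.of fun i j => (G i j).coeff 0

end CCF

/-! ### Weight enumerators and weight adjacency matrices -/

section Weights

variable {F : Type*} [Field F] [Fintype F] [DecidableEq F] {δ k n : ℕ}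

/-- The weight enumerator `∑_j α_j W^j` of a set of vectors, `α_j` being the number of its elements
of Hamming weight `j`. -/
noncomputable def weightEnum (S : Finset (Fin n → F)) : ℂ[X] :=
  ∑ j ∈ Finset.range (n + 1),
    Polynomial.C (((S.filter fun a => hammingNorm a = j).card : ℕ) : ℂ) * X ^ j

/-- The weight adjacency matrix, with entries `we({x C + u E | u ∈ F^k, y = x A + u B})`. -/
noncomputable def wam (R : StateSpace F δ k n) : Matrix (Fin δ → F) (Fin δ → F) ℂ[X] :=
  Matrix.of fun x y => weightEnum
    ((Finset.univ.filter fun u : Fin k → F => y = x ᵥ* R.A + u ᵥ* R.B).image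
      fun u => x ᵥ* R.C + u ᵥ* R.E)

/-- The permutation matrix `𝒫(P)` over `ℂ`, with entry `1` at `(x, y)` if `y = x P` and `0` else. -/
def permMatrix (P : Matrix (Fin δ) (Fin δ) F) : Matrix (Fin δ → F) (Fin δ → F) ℂ :=
  Matrix.of fun x y => if y = x ᵥ* P then 1 else 0

/-- The class `[Λ] = {𝒫(P) Λ 𝒫(P)⁻¹ | P ∈ GL_δ(F)}`. -/
noncomputable def generalizedWam (L : Matrix (Fin δ → F) (Fin δ → F) ℂ[X]) :
    Set (Matrix (Fin δ → F) (Fin δ → F) ℂ[X]) :=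
  {M | ∃ P : GL (Fin δ) F, M = (permMatrix (P : Matrix (Fin δ) (Fin δ) F)).map Polynomial.C * L *
    ((permMatrix (P : Matrix (Fin δ) (Fin δ) F))⁻¹).map Polynomial.C}

end Weights

/-! ### The MacWilliams transformations -/

section MacWilliams

/-- The MacWilliams transform `H(f)(W) = (1 + (q-1)W)^n f((1-W) / (1 + (q-1)W))` on polynomials of
degree at most `n`, with the denominators cleared. -/
noncomputable def macWilliamsTransform (q n : ℕ) (f : ℂ[X]) : ℂ[X] :=
  ∑ j ∈ Finset.range (n + 1),
    Polynomial.C (f.coeff j) * (1 - X) ^ j * (1 + Polynomial.C ((q : ℂ) - 1) * X) ^ (n - j)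

theorem eval_macWilliamsTransform (q n : ℕ) (f : ℂ[X]) (hf : f.natDegree ≤ n) (w : ℂ)
    (hw : 1 + ((q : ℂ) - 1) * w ≠ 0) :
    (macWilliamsTransform q n f).eval w =
      (1 + ((q : ℂ) - 1) * w) ^ n * f.eval ((1 - w) / (1 + ((q : ℂ) - 1) * w)) := by
  rw [Polynomial.eval_eq_sum_range' (Nat.lt_succ_of_le hf), Finset.mul_sum, macWilliamsTransform,
    Polynomial.eval_finsetSum]
  refine Finset.sum_congr rfl fun j hj => ?_
  have hj' : j ≤ n := Nat.lt_succ_iff.mp (Finset.mem_range.mp hj)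
  simp only [eval_mul, eval_C, eval_pow, eval_sub, eval_one, eval_X, eval_add]
  have h : (1 + ((q : ℂ) - 1) * w) ^ n =
      (1 + ((q : ℂ) - 1) * w) ^ (n - j) * (1 + ((q : ℂ) - 1) * w) ^ j := by
    rw [← pow_add, Nat.sub_add_cancel hj']
  have h0 : (1 + ((q : ℂ) - 1) * w) ^ j ≠ 0 := pow_ne_zero _ hw
  rw [h, div_pow]
  generalize (1 + ((q : ℂ) - 1) * w) ^ j = a at h0 ⊢
  field_simp

variable {F : Type*} [Field F] [Fintype F] [DecidableEq F] {δ : ℕ}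

/-- The MacWilliams matrix with entries `q^{-δ/2} ζ^{τ(x yᵀ)}`, where `τ : F → F_p` is the trace. -/
noncomputable def macWilliamsMatrix (F : Type*) [Field F] [Fintype F] (p : ℕ) [Algebra (ZMod p) F]
    (ζ : ℂ) (δ : ℕ) : Matrix (Fin δ → F) (Fin δ → F) ℂ :=
  Matrix.of fun x y =>
    (((Fintype.card F : ℝ) ^ (-(δ : ℝ) / 2) : ℝ) : ℂ) *
      ζ ^ (Algebra.trace (ZMod p) F (x ⬝ᵥ y)).val

/-- The trace is the form `a ↦ ∑_{i<s} a^{p^i}`, where `q = p^s`. -/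
theorem trace_eq_sum_pow (F : Type*) [Field F] [Fintype F] (p : ℕ) [Fact p.Prime]
    [Algebra (ZMod p) F] (s : ℕ) (hs : Fintype.card F = p ^ s) (a : F) :
    algebraMap (ZMod p) F (Algebra.trace (ZMod p) F a) = ∑ i ∈ Finset.range s, a ^ p ^ i := by
  have h : Module.finrank (ZMod p) F = s := by
    have := Module.card_eq_pow_finrank (K := ZMod p) (V := F)
    rw [hs, ZMod.card] at this
    exact (Nat.pow_right_injective (Fact.out : p.Prime).two_le this).symm
  rw [FiniteField.algebraMap_trace_eq_sum_pow, h, Nat.card_zmod]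

/-- The conjugated transpose `ℋ Λᵀ ℋ⁻¹`. -/
noncomputable def macWilliamsConj (p : ℕ) [Algebra (ZMod p) F] (ζ : ℂ)
    (L : Matrix (Fin δ → F) (Fin δ → F) ℂ[X]) : Matrix (Fin δ → F) (Fin δ → F) ℂ[X] :=
  (macWilliamsMatrix F p ζ δ).map Polynomial.C * Lᵀ *
    ((macWilliamsMatrix F p ζ δ)⁻¹).map Polynomial.C

/-- The matrix `q^{-k} H(ℋ Λᵀ ℋ⁻¹)`, where `H` is applied entrywise. -/
noncomputable def macWilliamsDual (p : ℕ) [Algebra (ZMod p) F] (ζ : ℂ) (n k : ℕ)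
    (L : Matrix (Fin δ → F) (Fin δ → F) ℂ[X]) : Matrix (Fin δ → F) (Fin δ → F) ℂ[X] :=
  (macWilliamsConj p ζ L).map fun f =>
    Polynomial.C (((Fintype.card F : ℂ) ^ k)⁻¹) * macWilliamsTransform (Fintype.card F) n f

end MacWilliams

/-! ### The explicit state space isomorphism -/

section Explicit

variable {F : Type*} [Field F] {δ k k' n : ℕ}

/-- `S_0 = Bᵀ E` and `S_i = Bᵀ B A^{i-1} C` for `i ≥ 1`. -/
def StateSpace.S (R : StateSpace F δ k n) : ℕ → Matrix (Fin δ) (Fin n) F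
  | 0 => R.Bᵀ * R.E
  | i + 1 => R.Bᵀ * R.B * R.A ^ i * R.C

/-- `N = ∑_{m ≥ 2} ∑_{i=1}^{m-1} ∑_{j=0}^{i-1} (Âᵀ)^{i-1} Ŝ_j S_{m-j}ᵀ A^{m-(i+1)}`, where `R` is
the system with matrices `A, …` and `R'` the one with matrices `Â, …`. For controller canonical
forms `A^δ = Â^δ = 0`, so all summands with `m > 2δ` vanish and are left out. -/
def matrixN (R : StateSpace F δ k n) (R' : StateSpace F δ k' n) : Matrix (Fin δ) (Fin δ) F :=
  ∑ m ∈ Finset.Icc 2 (2 * δ), ∑ i ∈ Finset.Icc 1 (m - 1), ∑ j ∈ Finset.range i,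
    (R'.Aᵀ) ^ (i - 1) * R'.S j * (R.S (m - j))ᵀ * R.A ^ (m - (i + 1))

/-- `P = Ĉ Eᵀ B - N A`. -/
def matrixP (R : StateSpace F δ k n) (R' : StateSpace F δ k' n) : Matrix (Fin δ) (Fin δ) F :=
  R'.C * R.Eᵀ * R.B - matrixN R R' * R.A

end Explicit

end ConvCode

open ConvCode

/-! Write `H` for the encoder of the dual code. Since `H * Gᵀ = 0`, the polynomial h_a(x)·g_b(y)
vanishes at x = y, so it is divisible by x - y. `bezoutian H G a b r s` is the coefficient of x^r
y^s in the quotient. Read off from the controller forms, `matrixP` is exactly the matrix of these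
coefficients, indexed by the state coordinates of both systems.

Comparing coefficients in (x - y)·B(x, y) = h_a(x)·g_b(y) gives P Aᵀ = Â P + Ĉ Cᵀ, P Bᵀ = Ĉ Eᵀ and
B̂ P = -Ê Cᵀ; also Ê Eᵀ = 0. Together they say that each transition x → y with output w of the dual
system is orthogonal to each transition z → z' with output v of the original one: xP·z' - yP·z - w·v
= 0. Conversely, every (xP, yP, w) orthogonal to all original transitions arises in this way
(`annihilates_iff_exists_input`), because P is invertible and the kernel of w ↦ w Eᵀ is the row
space of Ê.

Poisson summation with the trace character shows that q^{-k} H(ℋ Λᵀ ℋ⁻¹) enumerates precisely the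
outputs w orthogonal to all transitions (`macWilliams_wam`), which gives the entrywise formula.
Invertibility of P comes from `bezoutMatrix_vecMul_injective`: a left kernel vector would contradict
the predictable degree property of `H`. Applied to (H, G) and (G, H), the same injectivity forces
the two degrees to agree. -/

namespace ConvCode

/-! ### Exactness of complementary right invertible matrices -/

section Completion

variable {R ι κ κ' : Type*} [CommRing R] [Fintype ι] [Fintype κ] [Fintype κ']
  [DecidableEq ι] [DecidableEq κ] [DecidableEq κ']

/-- If `G` and `H` are right invertible, orthogonal and of complementary sizes, then every vector
orthogonal to the rows of `H` is a combination of the rows of `G`. -/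
theorem exists_vecMul_eq_of_orthogonal (e : ι ≃ κ ⊕ κ') {G : Matrix κ ι R} {H : Matrix κ' ι R}
    {G₁ : Matrix ι κ R} {H₁ : Matrix ι κ' R} (hG : G * G₁ = 1) (hH : H * H₁ = 1)
    (hGH : H * Gᵀ = 0) {w : ι → R} (hw : w ᵥ* Hᵀ = 0) : ∃ u, w = u ᵥ* G := by
  have hGH' : G * Hᵀ = 0 := by simpa using congrArg Matrix.transpose hGH
  have hH' : H₁ᵀ * Hᵀ = 1 := by simpa using congrArg Matrix.transpose hH
  -- The stacked product is block lower unitriangular, since `G * Hᵀ = 0`; `K` clears its lower left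
  -- block. The left inverse of the square matrix `fromCols G₁ Hᵀ` so obtained is two-sided, hence
  -- this matrix kills no nonzero row vector.
  let K : Matrix (κ ⊕ κ') (κ ⊕ κ') R := fromBlocks 1 0 (-(H₁ᵀ * G₁)) 1
  have h1 : (K * fromRows G H₁ᵀ) * fromCols G₁ Hᵀ = (1 : Matrix (κ ⊕ κ') (κ ⊕ κ') R) := by
    simp only [K]
    rw [Matrix.mul_assoc, fromRows_mul_fromCols, hG, hGH', hH', fromBlocks_multiply]
    simp
  have h2 := (Matrix.mul_eq_one_comm_of_equiv e.symm).1 h1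
  refine ⟨w ᵥ* G₁, ?_⟩
  have h3 : (w - w ᵥ* G₁ ᵥ* G) ᵥ* fromCols G₁ Hᵀ = 0 := by
    rw [vecMul_fromCols, sub_vecMul, sub_vecMul, vecMul_vecMul _ G, hG, vecMul_vecMul _ G, hGH', hw]
    ext i
    rcases i with i | i <;> simp
  have h4 := congrArg (fun v => v ᵥ* (K * fromRows G H₁ᵀ)) h3
  simp only [vecMul_vecMul, h2, vecMul_one, zero_vecMul] at h4
  exact sub_eq_zero.1 (by simpa [vecMul_vecMul] using h4)

end Completion

/-! ### Row-reduced polynomial matrices -/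

section Reduced

variable {F : Type*} [Field F] {k n : ℕ}

theorem natDegree_le_rowDegree (G : Matrix (Fin k) (Fin n) F[X]) (i : Fin k) (j : Fin n) :
    (G i j).natDegree ≤ rowDegree G i :=
  Finset.le_sup (f := fun j => (G i j).natDegree) (Finset.mem_univ j)

theorem coeff_eq_zero_of_rowDegree_lt (G : Matrix (Fin k) (Fin n) F[X]) {i : Fin k} {m : ℕ}
    (h : rowDegree G i < m) (j : Fin n) : (G i j).coeff m = 0 :=
  coeff_eq_zero_of_natDegree_lt ((natDegree_le_rowDegree G i j).trans_lt h)

/-- The matrix of leading row coefficients. -/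
noncomputable def leadCoeffMatrix (G : Matrix (Fin k) (Fin n) F[X]) : Matrix (Fin k) (Fin n) F :=
  Matrix.of fun i j => (G i j).coeff (rowDegree G i)

theorem natDegree_prod_le_and_coeff_prod {ι R : Type*} [CommRing R] (s : Finset ι) (f : ι → R[X])
    (d : ι → ℕ) (h : ∀ i, (f i).natDegree ≤ d i) :
    (∏ i ∈ s, f i).natDegree ≤ ∑ i ∈ s, d i ∧
      (∏ i ∈ s, f i).coeff (∑ i ∈ s, d i) = ∏ i ∈ s, (f i).coeff (d i) := by
  classical
  induction s using Finset.induction_on with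
  | empty => simp
  | insert a s ha ih =>
    simp only [Finset.prod_insert ha, Finset.sum_insert ha]
    exact ⟨natDegree_mul_le_of_le (h a) ih.1,
      by rw [coeff_mul_add_eq_of_natDegree_le (h a) ih.1, ih.2]⟩

theorem coeff_det_sum {ι R : Type*} [CommRing R] [Fintype ι] [DecidableEq ι] (M : Matrix ι ι R[X])
    (d : ι → ℕ) (h : ∀ i j, (M i j).natDegree ≤ d i) :
    M.det.coeff (∑ i, d i) = (Matrix.of fun i j => (M i j).coeff (d i)).det := by
  rw [← det_transpose M, ← det_transpose (Matrix.of _), det_apply, det_apply, finsetSum_coeff]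
  refine Finset.sum_congr rfl fun σ _ => ?_
  rw [coeff_smul]
  congr 1
  exact (natDegree_prod_le_and_coeff_prod Finset.univ (fun i => M i (σ i)) d fun i => h i _).2

/-- A minor of degree `∑ i, rowDegree G i` has as leading coefficient the corresponding minor of
`leadCoeffMatrix G`, which is therefore nonzero. Positivity of the degree is needed because a zero
minor, and an empty supremum, also count as degree 0. -/
theorem leadCoeffMatrix_vecMul_injective {G : Matrix (Fin k) (Fin n) F[X]}
    (hG : maxMinorDegree G = ∑ i, rowDegree G i) (hpos : 0 < ∑ i, rowDegree G i)
    {c : Fin k → F} (hc : c ᵥ* leadCoeffMatrix G = 0) : c = 0 := by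
  obtain ⟨s, hs⟩ : ∃ s : Fin k ↪ Fin n,
      (G.submatrix id s).det.natDegree = ∑ i, rowDegree G i := by
    rcases isEmpty_or_nonempty (Fin k ↪ Fin n) with he | he
    · exfalso
      rw [← hG, maxMinorDegree, Finset.univ_eq_empty, Finset.sup_empty] at hpos
      exact lt_irrefl _ hpos
    · obtain ⟨s, -, hs⟩ := Finset.exists_mem_eq_sup (Finset.univ : Finset (Fin k ↪ Fin n))
        Finset.univ_nonempty fun s => (G.submatrix id s).det.natDegree
      exact ⟨s, hs.symm.trans hG⟩
  have hdet : ((leadCoeffMatrix G).submatrix id s).det ≠ 0 := by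
    have h := coeff_det_sum (G.submatrix id s) (rowDegree G)
      fun i j => natDegree_le_rowDegree G i (s j)
    have h' : ((leadCoeffMatrix G).submatrix id s).det = (G.submatrix id s).det.leadingCoeff := by
      rw [leadingCoeff, hs, h]
      rfl
    rw [h', Ne, leadingCoeff_eq_zero]
    intro h0
    rw [h0, natDegree_zero] at hs
    omega
  refine Matrix.eq_zero_of_vecMul_eq_zero hdet ?_
  ext j
  exact congrFun hc (s j)

/-- The predictable degree property of a reduced matrix. -/
theorem coeff_eq_zero_of_coeff_vecMul_eq_zero {G : Matrix (Fin k) (Fin n) F[X]}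
    (hG : ∀ c : Fin k → F, c ᵥ* leadCoeffMatrix G = 0 → c = 0) (f : Fin k → F[X]) (M : ℕ)
    (h : ∀ j t, M ≤ t → ((f ᵥ* G) j).coeff t = 0) (a : Fin k) (t : ℕ)
    (ht : M ≤ t + rowDegree G a) : (f a).coeff t = 0 := by
  -- Descending induction on the total degree `d`, written as `d = T - e`; from `T` on there is
  -- nothing to prove, since `t` then exceeds the degree of `f a`.
  set T := ∑ a, ((f a).natDegree + rowDegree G a) + 1 with hT
  suffices H : ∀ e d, M ≤ d → T ≤ d + e → ∀ a t, d ≤ t + rowDegree G a → (f a).coeff t = 0 from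
    H T M le_rfl (by omega) a t ht
  intro e
  induction e with
  | zero =>
    intro d _ hd a t hat
    have := Finset.single_le_sum (f := fun a => (f a).natDegree + rowDegree G a)
      (fun _ _ => Nat.zero_le _) (Finset.mem_univ a)
    exact coeff_eq_zero_of_natDegree_lt (by omega)
  | succ e ih =>
    intro d hd hde
    have ih' := ih (d + 1) (by omega) (by omega)
    -- Once the terms of total degree above `d` are gone, the coefficient of D^d in `f ᵥ* G` is this
    -- vector times the leading coefficient matrix. Rows of degree above `d` contribute nothing.
    have key : (fun a => if rowDegree G a ≤ d then (f a).coeff (d - rowDegree G a) else 0) = 0 := by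
      apply hG
      ext j
      refine Eq.trans ?_ (h j d hd)
      rw [vecMul_eq_sum, vecMul_eq_sum, Finset.sum_apply, Finset.sum_apply, finsetSum_coeff]
      refine Finset.sum_congr rfl fun a _ => ?_
      rw [Pi.smul_apply, Pi.smul_apply, smul_eq_mul, smul_eq_mul, coeff_mul, leadCoeffMatrix,
        Matrix.of_apply]
      split_ifs with hda
      · rw [Finset.sum_eq_single (d - rowDegree G a, rowDegree G a)]
        · rintro ⟨x, y⟩ hxy hne
          rw [Finset.HasAntidiagonal.mem_antidiagonal] at hxy
          simp only at hxy ⊢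
          rcases lt_trichotomy y (rowDegree G a) with hy | hy | hy
          · rw [ih' a x (by omega), zero_mul]
          · exact absurd (Prod.ext (by omega) hy) hne
          · rw [coeff_eq_zero_of_rowDegree_lt G hy, mul_zero]
        · intro hn
          exact absurd (Finset.HasAntidiagonal.mem_antidiagonal.2 (by omega)) hn
      · rw [zero_mul, Finset.sum_eq_zero]
        rintro ⟨x, y⟩ hxy
        rw [Finset.HasAntidiagonal.mem_antidiagonal] at hxy
        simp only at hxy ⊢
        rw [ih' a x (by omega), zero_mul]
    intro a t hat
    rcases hat.lt_or_eq with hlt | heq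
    · exact ih' a t hlt
    · have := congrFun key a
      simp only [Pi.zero_apply] at this
      rw [if_pos (by omega)] at this
      rwa [show d - rowDegree G a = t by omega] at this

end Reduced

/-! ### The Bezoutian of two orthogonal encoders -/

section Bezout

variable {F : Type*} [Field F] {k k' n : ℕ}

/-- The coefficient vector of `D^m` in the `i`-th row of `G`. -/
noncomputable def rowCoeff (G : Matrix (Fin k) (Fin n) F[X]) (i : Fin k) (m : ℕ) : Fin n → F :=
  fun j => (G i j).coeff m

theorem rowCoeff_eq_zero (G : Matrix (Fin k) (Fin n) F[X]) {i : Fin k} {m : ℕ}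
    (h : rowDegree G i < m) : rowCoeff G i m = 0 :=
  funext fun j => coeff_eq_zero_of_rowDegree_lt G h j

theorem sum_rowCoeff_dotProduct {H : Matrix (Fin k') (Fin n) F[X]} {G : Matrix (Fin k) (Fin n) F[X]}
    (hHG : H * Gᵀ = 0) (a : Fin k') (b : Fin k) (m : ℕ) :
    ∑ i ∈ Finset.range (m + 1), rowCoeff H a i ⬝ᵥ rowCoeff G b (m - i) = 0 := by
  have h : ((H * Gᵀ) a b).coeff m = 0 := by rw [hHG]; simp
  rw [Matrix.mul_apply, finsetSum_coeff] at h
  rw [← h]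
  simp only [coeff_mul, dotProduct, rowCoeff, transpose_apply]
  rw [Finset.sum_comm]
  refine Finset.sum_congr rfl fun l _ => ?_
  rw [Finset.Nat.sum_antidiagonal_eq_sum_range_succ
    (fun i j => (H a l).coeff i * (G b l).coeff j)]

/-- The Bezoutian form of the rows `h_a` and `g_b`:
`∑_{c ≤ s} h_{a,r+1+c} · g_{b,s-c}`. -/
noncomputable def bezoutian (H : Matrix (Fin k') (Fin n) F[X]) (G : Matrix (Fin k) (Fin n) F[X])
    (a : Fin k') (b : Fin k) (r s : ℕ) : F :=
  ∑ c ∈ Finset.range (s + 1), rowCoeff H a (r + 1 + c) ⬝ᵥ rowCoeff G b (s - c)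

variable (H : Matrix (Fin k') (Fin n) F[X]) (G : Matrix (Fin k) (Fin n) F[X])

theorem bezoutian_zero_right (a : Fin k') (b : Fin k) (r : ℕ) :
    bezoutian H G a b r 0 = rowCoeff H a (r + 1) ⬝ᵥ rowCoeff G b 0 := by
  simp [bezoutian]

theorem bezoutian_succ_right (a : Fin k') (b : Fin k) (r s : ℕ) :
    bezoutian H G a b r (s + 1) =
      bezoutian H G a b (r + 1) s + rowCoeff H a (r + 1) ⬝ᵥ rowCoeff G b (s + 1) := by
  rw [bezoutian, Finset.sum_range_succ', bezoutian]
  refine congrArg₂ _ (Finset.sum_congr rfl fun c _ => ?_) rfl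
  rw [show r + 1 + (c + 1) = r + 1 + 1 + c by omega, Nat.add_sub_add_right]

theorem bezoutian_eq_zero_of_le_left {a : Fin k'} (b : Fin k) {r : ℕ} (s : ℕ)
    (hr : rowDegree H a ≤ r) : bezoutian H G a b r s = 0 :=
  Finset.sum_eq_zero fun c _ => by rw [rowCoeff_eq_zero H (by omega), zero_dotProduct]

variable {H G}

/-- The coefficient of D^(r+s+1) in h_a·g_b is zero. Cut the convolution sum after index `r`: the
upper half is the Bezoutian, the lower half is the kind of sum that occurs in `matrixN`. -/
theorem sum_range_rowCoeff_dotProduct (hHG : H * Gᵀ = 0) (a : Fin k') (b : Fin k) (r s : ℕ) :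
    ∑ j ∈ Finset.range (r + 1), rowCoeff H a j ⬝ᵥ rowCoeff G b (r + s + 1 - j) =
      -bezoutian H G a b r s := by
  have h := sum_rowCoeff_dotProduct hHG a b (r + s + 1)
  rw [show r + s + 1 + 1 = r + 1 + (s + 1) by omega, Finset.sum_range_add] at h
  rw [eq_neg_iff_add_eq_zero, ← h, bezoutian]
  congr 1
  refine Finset.sum_congr rfl fun c _ => ?_
  rw [show r + s + 1 - (r + 1 + c) = s - c by omega]

/-- Exchanging the two factors turns x - y into y - x. This carries the evident facts about one
index over to the other. -/
theorem bezoutian_swap (hHG : H * Gᵀ = 0) (a : Fin k') (b : Fin k) (r s : ℕ) :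
    bezoutian G H b a s r = -bezoutian H G a b r s := by
  rw [← sum_range_rowCoeff_dotProduct hHG, ← Finset.sum_range_reflect, bezoutian]
  refine Finset.sum_congr rfl fun c hc => ?_
  rw [Finset.mem_range] at hc
  rw [dotProduct_comm, show r + 1 - 1 - c = r - c by omega,
    show r + s + 1 - (r - c) = s + 1 + c by omega]

theorem bezoutian_eq_zero_of_le_right (hHG : H * Gᵀ = 0) (a : Fin k') {b : Fin k} (r : ℕ) {s : ℕ}
    (hs : rowDegree G b ≤ s) : bezoutian H G a b r s = 0 := by
  rw [← neg_eq_zero, ← bezoutian_swap hHG, bezoutian_eq_zero_of_le_left G H a r hs]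

theorem bezoutian_zero_left (hHG : H * Gᵀ = 0) (a : Fin k') (b : Fin k) (s : ℕ) :
    bezoutian H G a b 0 s = -(rowCoeff H a 0 ⬝ᵥ rowCoeff G b (s + 1)) := by
  rw [← neg_inj, ← bezoutian_swap hHG, bezoutian_zero_right, neg_neg, dotProduct_comm]

/-- The Bezoutian matrix of `H` and `G`, indexed by the state coordinates of the two matrices. -/
noncomputable def bezoutMatrix (H : Matrix (Fin k') (Fin n) F[X]) (G : Matrix (Fin k) (Fin n) F[X]) :
    Matrix (Σ a, Fin (rowDegree H a)) (Σ b, Fin (rowDegree G b)) F :=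
  Matrix.of fun x y => bezoutian H G x.1 y.1 x.2 y.2

theorem bezoutMatrix_vecMul_injective (hn : k + k' = n) (hH : IsBasic H) (hG : IsBasic G)
    (hHG : H * Gᵀ = 0) (hred : maxMinorDegree H = ∑ i, rowDegree H i)
    {v : (Σ a, Fin (rowDegree H a)) → F} (hv : v ᵥ* bezoutMatrix H G = 0) : v = 0 := by
  set M := ∑ a, rowDegree H a with hM
  have hle : ∀ a, rowDegree H a ≤ M := fun a =>
    Finset.single_le_sum (f := rowDegree H) (fun _ _ => Nat.zero_le _) (Finset.mem_univ a)
  rcases Nat.eq_zero_or_pos M with h0 | hpos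
  · ext ⟨a, r⟩
    exact absurd r.2 (by have := hle a; omega)
  have hlead := fun c => leadCoeffMatrix_vecMul_injective (c := c) hred hpos
  -- The exponents are reversed so that the part `w` of `h ᵥ* H` above D^M collects the shifted rows
  -- `∑ v ⟨a, r⟩ h_{a,r+1+c}`. The coefficient of D^s in `(w ᵥ* Gᵀ) b` is then entry `(b, s)` of `v
  -- ᵥ* bezoutMatrix H G`.
  let h : Fin k' → F[X] := fun a =>
    ∑ r : Fin (rowDegree H a), Polynomial.C (v ⟨a, r⟩) * X ^ (M - 1 - (r : ℕ))
  let w : Fin n → F[X] := fun l => (h ᵥ* H) l /ₘ X ^ M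
  let low : Fin n → F[X] := fun l => (h ᵥ* H) l %ₘ X ^ M
  have hsplit : ∀ l, (h ᵥ* H) l = low l + X ^ M * w l := fun l =>
    (modByMonic_add_div _ _).symm
  have hlow : ∀ l, (low l).degree < M := fun l => by
    simpa using degree_modByMonic_lt ((h ᵥ* H) l) (monic_X_pow M)
  have hlow' : ∀ l t, M ≤ t → (low l).coeff t = 0 := fun l t ht =>
    coeff_eq_zero_of_degree_lt ((hlow l).trans_le (by exact_mod_cast ht))
  have hlowdeg : ∀ l, (low l).natDegree ≤ M - 1 := fun l =>
    natDegree_le_iff_coeff_eq_zero.2 fun t ht => hlow' l t (by omega)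
  have hw : ∀ l c, (w l).coeff c = ∑ x : (Σ a, Fin (rowDegree H a)),
      v x * rowCoeff H x.1 (x.2 + 1 + c) l := by
    intro l c
    have h1 : ((h ᵥ* H) l).coeff (c + M) = (w l).coeff c := by
      rw [hsplit, coeff_add, hlow' l _ (by omega), zero_add, coeff_X_pow_mul]
    rw [← h1, vecMul_eq_sum, Finset.sum_apply, finsetSum_coeff, Fintype.sum_sigma]
    refine Finset.sum_congr rfl fun a _ => ?_
    rw [Pi.smul_apply, smul_eq_mul, Finset.sum_mul, finsetSum_coeff]
    refine Finset.sum_congr rfl fun r _ => ?_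
    have := hle a
    have := r.2
    rw [mul_assoc, coeff_C_mul, show c + M = (r + 1 + c) + (M - 1 - r) by omega, coeff_X_pow_mul,
      rowCoeff]
  have hwG : w ᵥ* Gᵀ = 0 := by
    ext b s
    rw [Pi.zero_apply, coeff_zero]
    rcases lt_or_ge s (rowDegree G b) with hs | hs
    · have hvs := congrFun hv ⟨b, ⟨s, hs⟩⟩
      rw [Pi.zero_apply] at hvs
      rw [← hvs, vecMul, dotProduct, finsetSum_coeff, vecMul, dotProduct]
      simp only [coeff_mul, transpose_apply, bezoutMatrix, Matrix.of_apply, bezoutian, dotProduct]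
      simp_rw [Finset.Nat.sum_antidiagonal_eq_sum_range_succ_mk, hw, Finset.sum_mul, Finset.mul_sum]
      rw [Finset.sum_comm]
      rw [Finset.sum_comm (s := (Finset.univ : Finset (Σ a, Fin (rowDegree H a))))]
      refine Finset.sum_congr rfl fun c _ => ?_
      rw [Finset.sum_comm]
      refine Finset.sum_congr rfl fun x _ => Finset.sum_congr rfl fun l _ => ?_
      rw [rowCoeff, rowCoeff, mul_assoc]
    -- Beyond the state coordinates a degree bound takes over: `h ᵥ* H` is orthogonal to `G`, and
    -- `low` has degree below `M`.
    · have h1 : X ^ M * (w ᵥ* Gᵀ) b = -(low ᵥ* Gᵀ) b := by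
        have h2 : ((h ᵥ* H) ᵥ* Gᵀ) b = 0 := by rw [vecMul_vecMul, hHG]; simp
        have h3 : h ᵥ* H = low + (X ^ M : F[X]) • w := by
          ext l : 1
          rw [hsplit]; rfl
        rw [h3, add_vecMul, smul_vecMul, Pi.add_apply, Pi.smul_apply, smul_eq_mul] at h2
        rw [eq_neg_iff_add_eq_zero, add_comm, h2]
      rw [← coeff_X_pow_mul _ M, h1, coeff_neg, neg_eq_zero, vecMul_eq_sum, Finset.sum_apply,
        finsetSum_coeff]
      refine Finset.sum_eq_zero fun l _ => ?_
      rw [Pi.smul_apply, smul_eq_mul]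
      refine coeff_eq_zero_of_natDegree_lt
        ((natDegree_mul_le_of_le (hlowdeg l) (natDegree_le_rowDegree G b l)).trans_lt ?_)
      omega
  obtain ⟨H₁, hH₁⟩ := hH
  obtain ⟨G₁, hG₁⟩ := hG
  have hGH : G * Hᵀ = 0 := by simpa using congrArg Matrix.transpose hHG
  obtain ⟨u, hu⟩ := exists_vecMul_eq_of_orthogonal
    ((finCongr (by omega)).trans finSumFinEquiv.symm : Fin n ≃ Fin k' ⊕ Fin k) hH₁ hG₁ hGH hwG
  -- By predictable degrees, entry `a` of `h - D^M u` has no terms of degree at least `M - rowDegree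
  -- H a`. The terms `v ⟨a, r⟩ D^(M-1-r)` lie in that range and are untouched by `D^M u`.
  have hf : (h - (X ^ M : F[X]) • u) ᵥ* H = low := by
    rw [sub_vecMul, smul_vecMul, ← hu]
    ext l : 1
    rw [Pi.sub_apply, hsplit, Pi.smul_apply, smul_eq_mul, add_sub_cancel_right]
  ext ⟨a, r⟩
  have hr := r.2
  have := hle a
  have hz := coeff_eq_zero_of_coeff_vecMul_eq_zero hlead _ M
    (fun j t ht => by rw [hf]; exact hlow' j t ht) a (M - 1 - r) (by omega)
  rw [Pi.sub_apply, Pi.smul_apply, smul_eq_mul, coeff_sub, coeff_X_pow_mul', if_neg (by omega),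
    sub_zero, finsetSum_coeff, Finset.sum_eq_single r] at hz
  · simpa using hz
  · intro r' _ hne
    have := r'.2
    rw [coeff_C_mul, coeff_X_pow, if_neg, mul_zero]
    intro h
    exact hne (Fin.ext (by omega))
  · simp

/-- The Bezout matrix has trivial left kernel, so it has at most as many rows as columns. With the
roles exchanged this yields equality of the degrees of a code and its dual. -/
theorem sum_rowDegree_le (hn : k + k' = n) (hH : IsBasic H) (hG : IsBasic G)
    (hHG : H * Gᵀ = 0) (hred : maxMinorDegree H = ∑ i, rowDegree H i) :
    ∑ i, rowDegree H i ≤ ∑ i, rowDegree G i := by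
  have hinj : Function.Injective (bezoutMatrix H G).vecMulLinear := by
    rw [← LinearMap.ker_eq_bot, LinearMap.ker_eq_bot']
    exact fun v hv => bezoutMatrix_vecMul_injective hn hH hG hHG hred hv
  simpa using LinearMap.finrank_le_finrank_of_injective hinj

end Bezout

/-! ### Controller forms, and `matrixP` as a Bezout matrix -/

section Entries

variable {F : Type*} [Field F] {δ k k' n : ℕ}

/-- The coordinate `(b, s)` need not exist; `hφ` covers that case. It holds for the coefficients and
Bezoutians used below, which vanish from the end of a block on. -/
theorem sum_ite_sigma_mul {d : Fin k → ℕ} (b : Fin k) (s : ℕ) (φ : Fin k → ℕ → F)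
    (hφ : d b ≤ s → φ b s = 0) :
    ∑ y : (Σ i, Fin (d i)), (if y.1 = b ∧ (y.2 : ℕ) = s then 1 else 0) * φ y.1 y.2 = φ b s := by
  rcases lt_or_ge s (d b) with h | h
  · rw [Finset.sum_eq_single ⟨b, ⟨s, h⟩⟩]
    · simp
    · rintro ⟨i, t⟩ _ hne
      rw [if_neg, zero_mul]
      rintro ⟨h1, h2⟩
      simp only at h1 h2
      subst h1
      exact hne (by congr; exact Fin.ext h2)
    · simp
  · rw [hφ h, Finset.sum_eq_zero]
    rintro ⟨i, t⟩ _
    rw [if_neg, zero_mul]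
    rintro ⟨h1, h2⟩
    simp only at h1 h2
    subst h1
    have := t.2
    omega

variable (G : Matrix (Fin k) (Fin n) F[X]) (hG : ∑ i, rowDegree G i = δ)

/-- The coefficient matrix of `D^m` in `G`. -/
noncomputable def coeffMatrix (m : ℕ) : Matrix (Fin k) (Fin n) F :=
  Matrix.of fun i => rowCoeff G i m

theorem ccf_A_apply (x y : Σ i, Fin (rowDegree G i)) :
    (ccf G hG).A (blockEquiv hG x) (blockEquiv hG y) =
      if y.1 = x.1 ∧ (y.2 : ℕ) = x.2 + 1 then 1 else 0 := by
  obtain ⟨i, s⟩ := x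
  obtain ⟨j, t⟩ := y
  simp only [ccf, Matrix.reindex_apply, Matrix.submatrix_apply, Equiv.symm_apply_apply]
  by_cases h : i = j
  · subst h
    rw [blockDiagonal'_apply_eq]
    simp
  · rw [blockDiagonal'_apply_ne _ _ _ h, if_neg fun h' => h h'.1.symm]

theorem ccf_B_apply (i : Fin k) (x : Σ i, Fin (rowDegree G i)) :
    (ccf G hG).B i (blockEquiv hG x) = if x.1 = i ∧ (x.2 : ℕ) = 0 then 1 else 0 := by
  simp [ccf]

theorem ccf_C_apply (x : Σ i, Fin (rowDegree G i)) :
    (ccf G hG).C (blockEquiv hG x) = rowCoeff G x.1 (x.2 + 1) := by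
  ext j
  simp [ccf, rowCoeff]

theorem ccf_E_eq : (ccf G hG).E = coeffMatrix G 0 := rfl

theorem rowDegree_le_of_sum_eq (h : ∑ i, rowDegree G i = δ) (i : Fin k) : rowDegree G i ≤ δ :=
  h ▸ Finset.single_le_sum (f := rowDegree G) (fun _ _ => Nat.zero_le _) (Finset.mem_univ i)

theorem ccf_B_mul_A_pow_apply (m : ℕ) (i : Fin k) (x : Σ i, Fin (rowDegree G i)) :
    ((ccf G hG).B * (ccf G hG).A ^ m) i (blockEquiv hG x) =
      if x.1 = i ∧ (x.2 : ℕ) = m then 1 else 0 := by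
  induction m generalizing x with
  | zero => rw [pow_zero, Matrix.mul_one, ccf_B_apply]
  | succ m ih =>
    rw [pow_succ, ← Matrix.mul_assoc, Matrix.mul_apply, ← (blockEquiv hG).sum_comp]
    simp only [ih, ccf_A_apply]
    rw [sum_ite_sigma_mul i m (fun j t => if x.1 = j ∧ (x.2 : ℕ) = t + 1 then (1 : F) else 0)]
    intro h
    rw [if_neg]
    rintro ⟨h1, h2⟩
    have := x.2.2
    have := congrArg (rowDegree G) h1
    omega

/-- Row `i` of `B * A ^ m` is the unit vector at coordinate `m` of block `i`, or zero if there is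
none, so multiplying by `C` extracts g_{i,m+1}. -/
theorem ccf_S_eq (m : ℕ) : (ccf G hG).S m = (ccf G hG).Bᵀ * coeffMatrix G m := by
  cases m with
  | zero => rfl
  | succ m =>
    rw [StateSpace.S, Matrix.mul_assoc, Matrix.mul_assoc, ← Matrix.mul_assoc _ _ (ccf G hG).C]
    congr 1
    ext i l
    rw [Matrix.mul_apply, ← (blockEquiv hG).sum_comp]
    simp only [ccf_B_mul_A_pow_apply, ccf_C_apply]
    rw [sum_ite_sigma_mul i m (fun j t => rowCoeff G j (t + 1) l)
      fun h => congrFun (rowCoeff_eq_zero G (by omega)) l]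
    rfl

variable {G} {H : Matrix (Fin k') (Fin n) F[X]} (hH : ∑ i, rowDegree H i = δ)

theorem matrixN_summand_apply (m i j : ℕ) (x : Σ i, Fin (rowDegree H i))
    (y : Σ i, Fin (rowDegree G i)) :
    (((ccf H hH).Aᵀ) ^ (i - 1) * (ccf H hH).S j * ((ccf G hG).S (m - j))ᵀ *
      (ccf G hG).A ^ (m - (i + 1))) (blockEquiv hH x) (blockEquiv hG y) =
      if (x.2 : ℕ) = i - 1 ∧ (y.2 : ℕ) = m - (i + 1) then
        rowCoeff H x.1 j ⬝ᵥ rowCoeff G y.1 (m - j) else 0 := by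
  have h1 : ((ccf H hH).Aᵀ) ^ (i - 1) * (ccf H hH).S j * ((ccf G hG).S (m - j))ᵀ *
      (ccf G hG).A ^ (m - (i + 1)) = ((ccf H hH).B * (ccf H hH).A ^ (i - 1))ᵀ *
        (coeffMatrix H j * (coeffMatrix G (m - j))ᵀ) *
        ((ccf G hG).B * (ccf G hG).A ^ (m - (i + 1))) := by
    rw [ccf_S_eq, ccf_S_eq]
    simp only [Matrix.transpose_mul, Matrix.transpose_pow, Matrix.transpose_transpose,
      Matrix.mul_assoc]
  rw [h1, Matrix.mul_apply]
  simp only [Matrix.mul_apply (M := (_ * _)ᵀ), Matrix.transpose_apply, ccf_B_mul_A_pow_apply]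
  have h2 : ∀ a b, (coeffMatrix H j * (coeffMatrix G (m - j))ᵀ) a b =
      rowCoeff H a j ⬝ᵥ rowCoeff G b (m - j) := fun a b => rfl
  simp only [h2]
  rw [Finset.sum_eq_single y.1, Finset.sum_eq_single x.1]
  · by_cases hx : (x.2 : ℕ) = i - 1 <;> by_cases hy : (y.2 : ℕ) = m - (i + 1) <;> simp [hx, hy]
  · intro a _ ha
    rw [if_neg fun h => ha h.1.symm, zero_mul]
  · simp
  · intro b _ hb
    rw [if_neg fun h => hb h.1.symm, mul_zero]
  · simp

theorem matrixN_apply (hHG : H * Gᵀ = 0) (x : Σ i, Fin (rowDegree H i))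
    (y : Σ i, Fin (rowDegree G i)) :
    matrixN (ccf G hG) (ccf H hH) (blockEquiv hH x) (blockEquiv hG y) =
      -bezoutian H G x.1 y.1 x.2 (y.2 + 1) := by
  have hx := x.2.2.trans_le (rowDegree_le_of_sum_eq H hH x.1)
  have hy := y.2.2.trans_le (rowDegree_le_of_sum_eq G hG y.1)
  rw [← sum_range_rowCoeff_dotProduct hHG, matrixN]
  simp only [Matrix.sum_apply, matrixN_summand_apply]
  -- At position (r, s) only i = r + 1 and m = r + s + 2 survive. Since r, s < δ, this m lies within
  -- the truncation at 2δ.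
  rw [Finset.sum_eq_single (x.2 + y.2 + 2 : ℕ), Finset.sum_eq_single (x.2 + 1 : ℕ)]
  · refine Finset.sum_congr rfl fun j _ => ?_
    rw [if_pos (by omega), ← add_assoc]
  · intro i hi hne
    rw [Finset.mem_Icc] at hi
    exact Finset.sum_eq_zero fun j _ => if_neg (by omega)
  · intro h
    exact absurd (Finset.mem_Icc.2 (by omega)) h
  · intro m hm hne
    rw [Finset.mem_Icc] at hm
    refine Finset.sum_eq_zero fun i hi => Finset.sum_eq_zero fun j _ => if_neg ?_
    rw [Finset.mem_Icc] at hi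
    omega
  · intro h
    exact absurd (Finset.mem_Icc.2 (by omega)) h

/-- Right multiplication by `A` shifts the columns of N within each block, so `-N A` supplies all
Bezoutian entries except those in the first column of a block, and `Ĉ Eᵀ B` supplies these. -/
theorem matrixP_apply (hHG : H * Gᵀ = 0) (x : Σ i, Fin (rowDegree H i))
    (y : Σ i, Fin (rowDegree G i)) :
    matrixP (ccf G hG) (ccf H hH) (blockEquiv hH x) (blockEquiv hG y) =
      bezoutian H G x.1 y.1 x.2 y.2 := by
  have h1 : ((ccf H hH).C * (ccf G hG).Eᵀ * (ccf G hG).B) (blockEquiv hH x) (blockEquiv hG y) =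
      if (y.2 : ℕ) = 0 then rowCoeff H x.1 (x.2 + 1) ⬝ᵥ rowCoeff G y.1 0 else 0 := by
    have h2 : ∀ b, ((ccf H hH).C * (ccf G hG).Eᵀ) (blockEquiv hH x) b =
        rowCoeff H x.1 (x.2 + 1) ⬝ᵥ rowCoeff G b 0 := fun b => by
      rw [← ccf_C_apply H hH]; rfl
    rw [Matrix.mul_apply]
    simp only [h2, ccf_B_apply]
    rw [Finset.sum_eq_single y.1]
    · simp
    · intro b _ hb
      rw [if_neg fun h => hb h.1.symm, mul_zero]
    · simp
  have h3 : (matrixN (ccf G hG) (ccf H hH) * (ccf G hG).A) (blockEquiv hH x) (blockEquiv hG y) =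
      if (y.2 : ℕ) = 0 then 0 else -bezoutian H G x.1 y.1 x.2 y.2 := by
    rw [Matrix.mul_apply, ← (blockEquiv hG).sum_comp]
    simp only [matrixN_apply hG hH hHG, ccf_A_apply]
    obtain ⟨b, s⟩ := y
    simp only
    split_ifs with hs
    · exact Finset.sum_eq_zero fun z _ => by rw [if_neg (by omega), mul_zero]
    · have hs' := s.2
      rw [Finset.sum_eq_single ⟨b, ⟨s - 1, by omega⟩⟩]
      · have : (s : ℕ) - 1 + 1 = s := by omega
        simp [this]
      · rintro ⟨c, t⟩ _ hne
        rw [if_neg, mul_zero]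
        rintro ⟨h1, h2⟩
        simp only at h1 h2
        subst h1
        exact hne (by congr; exact Fin.ext (by simp only; omega))
      · simp
  rw [matrixP, Matrix.sub_apply, h1, h3]
  split_ifs with hs
  · rw [sub_zero, hs, bezoutian_zero_right]
  · rw [zero_sub, neg_neg]

theorem matrixP_eq_reindex (hHG : H * Gᵀ = 0) :
    matrixP (ccf G hG) (ccf H hH) =
      Matrix.reindex (blockEquiv hH) (blockEquiv hG) (bezoutMatrix H G) := by
  ext i j
  obtain ⟨x, rfl⟩ := (blockEquiv hH).surjective i
  obtain ⟨y, rfl⟩ := (blockEquiv hG).surjective j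
  rw [matrixP_apply hG hH hHG]
  simp [bezoutMatrix]

/-- This is the recursion B_{r,s+1} = B_{r+1,s} + h_{r+1}·g_{s+1}, with `Aᵀ` and `Â` acting as index
shifts. At block ends the missing entries are zero. -/
theorem matrixP_mul_transpose_A (hHG : H * Gᵀ = 0) :
    matrixP (ccf G hG) (ccf H hH) * (ccf G hG).Aᵀ =
      (ccf H hH).A * matrixP (ccf G hG) (ccf H hH) + (ccf H hH).C * (ccf G hG).Cᵀ := by
  ext i j
  obtain ⟨x, rfl⟩ := (blockEquiv hH).surjective i
  obtain ⟨y, rfl⟩ := (blockEquiv hG).surjective j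
  have h1 : ((ccf H hH).C * (ccf G hG).Cᵀ) (blockEquiv hH x) (blockEquiv hG y) =
      rowCoeff H x.1 (x.2 + 1) ⬝ᵥ rowCoeff G y.1 (y.2 + 1) := by
    rw [← ccf_C_apply H hH, ← ccf_C_apply G hG]; rfl
  rw [Matrix.add_apply, h1, Matrix.mul_apply, Matrix.mul_apply, ← (blockEquiv hG).sum_comp,
    ← (blockEquiv hH).sum_comp]
  simp only [matrixP_apply hG hH hHG, ccf_A_apply, Matrix.transpose_apply]
  simp only [mul_comm (bezoutian H G _ _ _ _)]
  rw [sum_ite_sigma_mul y.1 (y.2 + 1) (fun b s => bezoutian H G x.1 b x.2 s)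
      (bezoutian_eq_zero_of_le_right hHG _ _),
    sum_ite_sigma_mul x.1 (x.2 + 1) (fun a r => bezoutian H G a y.1 r y.2)
      (bezoutian_eq_zero_of_le_left H G _ _), bezoutian_succ_right]

theorem matrixP_mul_transpose_B (hHG : H * Gᵀ = 0) :
    matrixP (ccf G hG) (ccf H hH) * (ccf G hG).Bᵀ = (ccf H hH).C * (ccf G hG).Eᵀ := by
  ext i b
  obtain ⟨x, rfl⟩ := (blockEquiv hH).surjective i
  have h1 : ((ccf H hH).C * (ccf G hG).Eᵀ) (blockEquiv hH x) b =
      rowCoeff H x.1 (x.2 + 1) ⬝ᵥ rowCoeff G b 0 := by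
    rw [← ccf_C_apply H hH]; rfl
  rw [h1, Matrix.mul_apply, ← (blockEquiv hG).sum_comp]
  simp only [matrixP_apply hG hH hHG, ccf_B_apply, Matrix.transpose_apply]
  simp only [mul_comm (bezoutian H G _ _ _ _)]
  rw [sum_ite_sigma_mul b 0 (fun b s => bezoutian H G x.1 b x.2 s)
      (bezoutian_eq_zero_of_le_right hHG _ _), bezoutian_zero_right]

theorem B_mul_matrixP (hHG : H * Gᵀ = 0) :
    (ccf H hH).B * matrixP (ccf G hG) (ccf H hH) = -((ccf H hH).E * (ccf G hG).Cᵀ) := by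
  ext a j
  obtain ⟨y, rfl⟩ := (blockEquiv hG).surjective j
  have h1 : ((ccf H hH).E * (ccf G hG).Cᵀ) a (blockEquiv hG y) =
      rowCoeff H a 0 ⬝ᵥ rowCoeff G y.1 (y.2 + 1) := by
    rw [← ccf_C_apply G hG]; rfl
  rw [Matrix.neg_apply, h1, Matrix.mul_apply, ← (blockEquiv hH).sum_comp]
  simp only [matrixP_apply hG hH hHG, ccf_B_apply]
  rw [sum_ite_sigma_mul a 0 (fun a r => bezoutian H G a y.1 r y.2)
      (bezoutian_eq_zero_of_le_left H G _ _), bezoutian_zero_left hHG]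

theorem E_mul_transpose_E (hHG : H * Gᵀ = 0) : (ccf H hH).E * (ccf G hG).Eᵀ = 0 := by
  ext a b
  have h := sum_rowCoeff_dotProduct hHG a b 0
  rw [Finset.sum_range_one] at h
  exact h

/-- Evaluate the right inverse at D = 0. -/
theorem IsBasic.coeffMatrix_zero (h : IsBasic G) : ∃ E₁ : Matrix (Fin n) (Fin k) F,
    coeffMatrix G 0 * E₁ = 1 := by
  obtain ⟨G₁, hG₁⟩ := h
  refine ⟨G₁.map constantCoeff, ?_⟩
  have := congrArg (fun M : Matrix (Fin k) (Fin k) F[X] => M.map constantCoeff) hG₁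
  simp only [Matrix.map_mul, Matrix.map_one _ (map_zero _) (map_one _)] at this
  exact this

end Entries

/-! ### Weight enumerators and additive characters -/

theorem weightEnum_eq_sum {F : Type*} [Field F] [DecidableEq F] {n : ℕ} (S : Finset (Fin n → F)) :
    weightEnum S = ∑ a ∈ S, X ^ hammingNorm a := by
  rw [weightEnum, ← Finset.sum_fiberwise_of_maps_to (s := S) (t := Finset.range (n + 1))
    (g := fun a => hammingNorm a)]
  · refine Finset.sum_congr rfl fun j _ => ?_
    rw [Finset.sum_congr rfl fun a ha => by rw [(Finset.mem_filter.1 ha).2]]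
    simp
  · intro a _
    simpa [Nat.lt_succ_iff] using hammingNorm_le_card_fintype (x := a)

section Characters

variable {F : Type*} [Field F] {p : ℕ} [Fact p.Prime] [Algebra (ZMod p) F] {ζ : ℂ}

/-- The additive character `a ↦ ζ^{τ(a)}` of `F`. -/
noncomputable def traceChar (F : Type*) [Field F] [Algebra (ZMod p) F]
    (hζ : IsPrimitiveRoot ζ p) : AddChar F ℂ :=
  (AddChar.zmodChar p hζ.pow_eq_one).compAddMonoidHom (Algebra.trace (ZMod p) F).toAddMonoidHom

theorem traceChar_apply (hζ : IsPrimitiveRoot ζ p) (a : F) :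
    traceChar F hζ a = ζ ^ (Algebra.trace (ZMod p) F a).val := rfl

variable [Fintype F]

theorem traceChar_isPrimitive (hζ : IsPrimitiveRoot ζ p) : (traceChar F hζ).IsPrimitive := by
  apply AddChar.IsPrimitive.of_ne_one
  obtain ⟨a, ha⟩ := Algebra.trace_surjective (ZMod p) F 1
  intro h
  have h1 : traceChar F hζ a = 1 := by rw [h]; rfl
  rw [traceChar_apply, ha, ZMod.val_one, pow_one] at h1
  exact hζ.ne_one (Fact.out : p.Prime).one_lt h1

theorem addChar_sum_eq_prod {A M ι : Type*} [AddCommMonoid A] [CommMonoid M] (ψ : AddChar A M)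
    (s : Finset ι) (f : ι → A) : ψ (∑ i ∈ s, f i) = ∏ i ∈ s, ψ (f i) := by
  classical
  induction s using Finset.induction_on with
  | empty => simp
  | insert a s ha ih =>
    rw [Finset.sum_insert ha, Finset.prod_insert ha, AddChar.map_add_eq_mul, ih]

variable [DecidableEq F]

theorem sum_addChar_dotProduct {ψ : AddChar F ℂ} (hψ : ψ.IsPrimitive) {m : ℕ} (c : Fin m → F) :
    ∑ z : Fin m → F, ψ (z ⬝ᵥ c) = if c = 0 then (Fintype.card F : ℂ) ^ m else 0 := by
  have h : ∀ z : Fin m → F, ψ (z ⬝ᵥ c) = ∏ i, ψ (z i * c i) := fun z => by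
    rw [dotProduct, addChar_sum_eq_prod]
  simp only [h]
  rw [← Fintype.prod_sum (fun i t => ψ (t * c i))]
  simp only [AddChar.sum_mulShift _ hψ]
  split_ifs with hc
  · simp [hc]
  · obtain ⟨i, hi⟩ := Function.ne_iff.1 hc
    exact Finset.prod_eq_zero (Finset.mem_univ i) (by simpa using hi)

/-- The MacWilliams transform of the weight monomial of a vector. -/
theorem sum_addChar_mul_X_pow {ψ : AddChar F ℂ} (hψ : ψ.IsPrimitive) {n : ℕ} (v : Fin n → F) :
    ∑ w : Fin n → F, Polynomial.C (ψ (-(v ⬝ᵥ w))) * X ^ hammingNorm w =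
      (1 - X) ^ hammingNorm v *
        (1 + Polynomial.C ((Fintype.card F : ℂ) - 1) * X) ^ (n - hammingNorm v) := by
  have h : ∀ w : Fin n → F, Polynomial.C (ψ (-(v ⬝ᵥ w))) * X ^ hammingNorm w =
      ∏ i, (Polynomial.C (ψ (w i * -v i)) * if w i = 0 then (1 : ℂ[X]) else X) := fun w => by
    rw [Finset.prod_mul_distrib, ← map_prod, ← addChar_sum_eq_prod, dotProduct,
      ← Finset.sum_neg_distrib, Finset.prod_ite, Finset.prod_const_one, one_mul, Finset.prod_const,
      hammingNorm]
    simp only [mul_neg, mul_comm (v _)]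
  have hcoord : ∀ a : F, ∑ t : F, (Polynomial.C (ψ (t * -a)) * if t = 0 then (1 : ℂ[X]) else X) =
      if a = 0 then 1 + Polynomial.C ((Fintype.card F : ℂ) - 1) * X else 1 - X := by
    intro a
    -- Give every `t` the weight X and correct by 1 - X at `t = 0`, so that orthogonality of
    -- characters applies to the full sum.
    have h1 : ∀ t : F, (Polynomial.C (ψ (t * -a)) * if t = 0 then (1 : ℂ[X]) else X) =
        Polynomial.C (ψ (t * -a)) * X + if t = 0 then 1 - X else 0 := fun t => by
      by_cases ht : t = 0 <;> simp [ht]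
    simp only [h1, Finset.sum_add_distrib, ← Finset.sum_mul, ← map_sum,
      AddChar.sum_mulShift _ hψ, neg_eq_zero]
    split_ifs
    · simp only [map_natCast, map_sub, map_one, Finset.sum_ite_eq', Finset.mem_univ, if_true]
      ring
    · simp
  simp only [h]
  rw [← Fintype.prod_sum
    (fun i t => (Polynomial.C (ψ (t * -v i)) * if t = 0 then (1 : ℂ[X]) else X))]
  simp only [hcoord]
  rw [Finset.prod_ite, Finset.prod_const, Finset.prod_const, mul_comm]
  congr 2
  rw [hammingNorm]
  refine eq_tsub_of_add_eq ?_
  rw [Finset.card_filter_add_card_filter_not, Finset.card_univ, Fintype.card_fin]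

theorem macWilliamsTransform_sum {ι : Type*} (q n : ℕ) (s : Finset ι) (c : ι → ℂ) (d : ι → ℕ)
    (hd : ∀ i ∈ s, d i ≤ n) :
    macWilliamsTransform q n (∑ i ∈ s, Polynomial.C (c i) * X ^ d i) =
      ∑ i ∈ s, Polynomial.C (c i) *
        ((1 - X) ^ d i * (1 + Polynomial.C ((q : ℂ) - 1) * X) ^ (n - d i)) := by
  simp only [macWilliamsTransform, finsetSum_coeff, map_sum, Finset.sum_mul]
  rw [Finset.sum_comm]
  refine Finset.sum_congr rfl fun i hi => ?_
  rw [Finset.sum_eq_single (d i)]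
  · rw [coeff_C_mul_X_pow, if_pos rfl, mul_assoc]
  · intro j _ hj
    rw [coeff_C_mul_X_pow, if_neg hj, map_zero, zero_mul, zero_mul]
  · intro h
    exact absurd (Finset.mem_range.2 (Nat.lt_succ_of_le (hd i hi))) h

variable {δ k n : ℕ}

theorem rpow_neg_half_mul_self (q : ℝ) (hq : 0 < q) (δ : ℕ) :
    ((q ^ (-(δ : ℝ) / 2) : ℝ) : ℂ) * ((q ^ (-(δ : ℝ) / 2) : ℝ) : ℂ) = ((q : ℂ) ^ δ)⁻¹ := by
  rw [← Complex.ofReal_mul, ← Real.rpow_add hq, add_halves, Real.rpow_neg hq.le, Real.rpow_natCast]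
  push_cast
  rfl

theorem macWilliamsMatrix_inv (hζ : IsPrimitiveRoot ζ p) (δ : ℕ) :
    (macWilliamsMatrix F p ζ δ)⁻¹ = Matrix.of fun x y =>
      (((Fintype.card F : ℝ) ^ (-(δ : ℝ) / 2) : ℝ) : ℂ) * traceChar F hζ (-(x ⬝ᵥ y)) := by
  have hq : (0 : ℝ) < Fintype.card F := by exact_mod_cast Fintype.card_pos
  have hq' : (Fintype.card F : ℂ) ≠ 0 := by exact_mod_cast Fintype.card_ne_zero
  refine Matrix.inv_eq_right_inv ?_
  ext x y
  rw [Matrix.mul_apply]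
  simp only [macWilliamsMatrix, Matrix.of_apply, ← traceChar_apply hζ]
  have h : ∀ z : Fin δ → F, traceChar F hζ (x ⬝ᵥ z) * traceChar F hζ (-(z ⬝ᵥ y)) =
      traceChar F hζ (z ⬝ᵥ (x - y)) := fun z => by
    rw [← AddChar.map_add_eq_mul, dotProduct_sub, dotProduct_comm x, sub_eq_add_neg]
  simp only [mul_mul_mul_comm _ (traceChar F hζ _), rpow_neg_half_mul_self _ hq, h]
  rw [← Finset.mul_sum, sum_addChar_dotProduct (traceChar_isPrimitive hζ), Matrix.one_apply]
  simp only [sub_eq_zero]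
  split_ifs
  · push_cast
    exact inv_mul_cancel₀ (pow_ne_zero _ hq')
  · rw [mul_zero]

theorem macWilliamsConj_apply (hζ : IsPrimitiveRoot ζ p)
    (L : Matrix (Fin δ → F) (Fin δ → F) ℂ[X]) (x y : Fin δ → F) :
    macWilliamsConj p ζ L x y = ∑ z, ∑ z', Polynomial.C (((Fintype.card F : ℂ) ^ δ)⁻¹ *
      traceChar F hζ (x ⬝ᵥ z' - z ⬝ᵥ y)) * L z z' := by
  have hq : (0 : ℝ) < Fintype.card F := by exact_mod_cast Fintype.card_pos
  have hs := rpow_neg_half_mul_self _ hq δ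
  rw [macWilliamsConj, macWilliamsMatrix_inv hζ, Matrix.mul_apply]
  refine Finset.sum_congr rfl fun z _ => ?_
  rw [Matrix.mul_apply, Finset.sum_mul]
  refine Finset.sum_congr rfl fun z' _ => ?_
  simp only [macWilliamsMatrix, Matrix.map_apply, Matrix.of_apply, Matrix.transpose_apply,
    ← traceChar_apply hζ]
  rw [Complex.ofReal_natCast] at hs
  rw [← hs, sub_eq_add_neg, AddChar.map_add_eq_mul]
  simp only [map_mul]
  ring

end Characters

/-! ### The transformed adjacency matrix as an enumerator of annihilators -/

section Duality

variable {F : Type*} [Field F] [Fintype F] [DecidableEq F] {p : ℕ} [Fact p.Prime]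
  [Algebra (ZMod p) F] {ζ : ℂ} {δ k n : ℕ}

/-- For a fixed state, distinct inputs give distinct outputs, so the set of outputs may be replaced
by a sum over inputs. -/
theorem wam_apply_eq_sum (R : StateSpace F δ k n) (hE : ∀ u, u ᵥ* R.E = 0 → u = 0)
    (x y : Fin δ → F) :
    wam R x y = ∑ u, if y = x ᵥ* R.A + u ᵥ* R.B then X ^ hammingNorm (x ᵥ* R.C + u ᵥ* R.E)
      else (0 : ℂ[X]) := by
  rw [wam, Matrix.of_apply, weightEnum_eq_sum, Finset.sum_image, Finset.sum_filter]
  intro u _ u' _ h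
  exact sub_eq_zero.1 (hE _ (by rw [sub_vecMul, sub_eq_zero]; exact add_left_cancel h))

/-- The MacWilliams transform of the weight adjacency matrix enumerates the outputs `w` that
annihilate the system. -/
theorem macWilliams_wam (hζ : IsPrimitiveRoot ζ p) (R : StateSpace F δ k n)
    (hE : ∀ u, u ᵥ* R.E = 0 → u = 0) (x y : Fin δ → F) :
    Polynomial.C (((Fintype.card F : ℂ) ^ k)⁻¹) *
      macWilliamsTransform (Fintype.card F) n (macWilliamsConj p ζ (wam R) x y) =
    ∑ w : Fin n → F, if R.A *ᵥ x - y - R.C *ᵥ w = 0 ∧ R.B *ᵥ x - R.E *ᵥ w = 0 then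
      X ^ hammingNorm w else 0 := by
  have hq : (Fintype.card F : ℂ) ≠ 0 := by exact_mod_cast Fintype.card_ne_zero
  have hψ := traceChar_isPrimitive (F := F) hζ
  have h1 : macWilliamsConj p ζ (wam R) x y = ∑ zu : (Fin δ → F) × (Fin k → F),
      Polynomial.C (((Fintype.card F : ℂ) ^ δ)⁻¹ *
        traceChar F hζ (x ⬝ᵥ (zu.1 ᵥ* R.A + zu.2 ᵥ* R.B) - zu.1 ⬝ᵥ y)) *
        X ^ hammingNorm (zu.1 ᵥ* R.C + zu.2 ᵥ* R.E) := by
    rw [macWilliamsConj_apply hζ, Fintype.sum_prod_type]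
    refine Finset.sum_congr rfl fun z _ => ?_
    simp only [wam_apply_eq_sum R hE, Finset.mul_sum]
    rw [Finset.sum_comm]
    refine Finset.sum_congr rfl fun u _ => ?_
    simp
  -- Transposing the matrices separates `z` from `u`. The two character sums then detect the two
  -- annihilator equations, and their values q^δ and q^k cancel the normalising factors.
  have h2 : ∀ (z : Fin δ → F) (u : Fin k → F) (w : Fin n → F),
      traceChar F hζ (x ⬝ᵥ (z ᵥ* R.A + u ᵥ* R.B) - z ⬝ᵥ y) *
        traceChar F hζ (-((z ᵥ* R.C + u ᵥ* R.E) ⬝ᵥ w)) =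
      traceChar F hζ (z ⬝ᵥ (R.A *ᵥ x - y - R.C *ᵥ w)) *
        traceChar F hζ (u ⬝ᵥ (R.B *ᵥ x - R.E *ᵥ w)) := fun z u w => by
    rw [← AddChar.map_add_eq_mul, ← AddChar.map_add_eq_mul]
    congr 1
    simp only [dotProduct_sub, dotProduct_mulVec, add_dotProduct, dotProduct_comm x]
    ring
  rw [h1, macWilliamsTransform_sum]
  · simp only [← sum_addChar_mul_X_pow hψ, Finset.mul_sum]
    rw [Finset.sum_comm]
    refine Finset.sum_congr rfl fun w _ => ?_
    have h3 : ∀ zu : (Fin δ → F) × (Fin k → F), Polynomial.C (((Fintype.card F : ℂ) ^ k)⁻¹) *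
        (Polynomial.C (((Fintype.card F : ℂ) ^ δ)⁻¹ *
        traceChar F hζ (x ⬝ᵥ (zu.1 ᵥ* R.A + zu.2 ᵥ* R.B) - zu.1 ⬝ᵥ y)) *
        (Polynomial.C (traceChar F hζ (-((zu.1 ᵥ* R.C + zu.2 ᵥ* R.E) ⬝ᵥ w))) *
          X ^ hammingNorm w)) =
        Polynomial.C (((Fintype.card F : ℂ) ^ k)⁻¹ * ((Fintype.card F : ℂ) ^ δ)⁻¹ *
          (traceChar F hζ (zu.1 ⬝ᵥ (R.A *ᵥ x - y - R.C *ᵥ w)) *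
          traceChar F hζ (zu.2 ⬝ᵥ (R.B *ᵥ x - R.E *ᵥ w)))) * X ^ hammingNorm w := fun zu => by
      rw [← h2]
      simp only [map_mul]
      ring
    simp only [h3]
    rw [← Finset.sum_mul, ← map_sum, ← Finset.mul_sum]
    rw [Fintype.sum_prod_type]
    dsimp only
    rw [← Finset.sum_mul_sum, sum_addChar_dotProduct hψ, sum_addChar_dotProduct hψ]
    by_cases ha : R.A *ᵥ x - y - R.C *ᵥ w = 0
    · by_cases hb : R.B *ᵥ x - R.E *ᵥ w = 0
      · rw [if_pos ha, if_pos hb, if_pos ⟨ha, hb⟩]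
        have : ((Fintype.card F : ℂ) ^ k)⁻¹ * ((Fintype.card F : ℂ) ^ δ)⁻¹ *
            ((Fintype.card F : ℂ) ^ δ * (Fintype.card F : ℂ) ^ k) = 1 := by
          field_simp
        rw [this, map_one, one_mul]
      · rw [if_neg hb, if_neg (not_and_of_not_right _ hb)]
        simp
    · rw [if_neg ha, if_neg (not_and_of_not_left _ ha)]
      simp
  · intro zu _
    simpa using hammingNorm_le_card_fintype (x := zu.1 ᵥ* R.C + zu.2 ᵥ* R.E)

end Duality

/-! ### State space isomorphisms and the MacWilliams conjugation -/

section Permutations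

variable {F : Type*} [Field F] {δ : ℕ}

/-- The action of `P` on matrices indexed by states: rows and columns are permuted by `x ↦ x P`. -/
def permute (P : Matrix (Fin δ) (Fin δ) F) (L : Matrix (Fin δ → F) (Fin δ → F) ℂ[X]) :
    Matrix (Fin δ → F) (Fin δ → F) ℂ[X] :=
  L.submatrix (fun x => x ᵥ* P) (fun x => x ᵥ* P)

theorem permute_permute (P Q : Matrix (Fin δ) (Fin δ) F)
    (L : Matrix (Fin δ → F) (Fin δ → F) ℂ[X]) : permute P (permute Q L) = permute (P * Q) L := by
  ext1 x y
  simp [permute]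

variable [Fintype F] [DecidableEq F]

theorem permMatrix_inv (P : GL (Fin δ) F) :
    (permMatrix (P : Matrix (Fin δ) (Fin δ) F))⁻¹ =
      permMatrix ((P⁻¹ : GL (Fin δ) F) : Matrix (Fin δ) (Fin δ) F) := by
  refine Matrix.inv_eq_right_inv ?_
  ext x y
  rw [Matrix.mul_apply, Finset.sum_eq_single (x ᵥ* (P : Matrix (Fin δ) (Fin δ) F))]
  · simp only [permMatrix, Matrix.of_apply, if_true, one_mul, vecMul_vecMul, Units.mul_inv,
      vecMul_one, Matrix.one_apply, eq_comm]
  · intro z _ hz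
    rw [permMatrix, Matrix.of_apply, if_neg hz, zero_mul]
  · simp

theorem permMatrix_conj (P : GL (Fin δ) F) (L : Matrix (Fin δ → F) (Fin δ → F) ℂ[X]) :
    (permMatrix (P : Matrix (Fin δ) (Fin δ) F)).map Polynomial.C * L *
      ((permMatrix (P : Matrix (Fin δ) (Fin δ) F))⁻¹).map Polynomial.C =
    permute (P : Matrix (Fin δ) (Fin δ) F) L := by
  rw [permMatrix_inv]
  ext1 x y
  rw [Matrix.mul_apply]
  have h : ∀ z, y = z ᵥ* ((P⁻¹ : GL (Fin δ) F) : Matrix (Fin δ) (Fin δ) F) ↔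
      z = y ᵥ* (P : Matrix (Fin δ) (Fin δ) F) := fun z => by
    constructor
    · rintro rfl
      rw [vecMul_vecMul, Units.inv_mul, vecMul_one]
    · rintro rfl
      rw [vecMul_vecMul, Units.mul_inv, vecMul_one]
  simp [permMatrix, Matrix.mul_apply, permute, h, apply_ite Polynomial.C, -coe_units_inv]

theorem mem_generalizedWam {L M : Matrix (Fin δ → F) (Fin δ → F) ℂ[X]} :
    M ∈ generalizedWam L ↔ ∃ P : GL (Fin δ) F, M = permute (P : Matrix (Fin δ) (Fin δ) F) L := by
  simp only [generalizedWam, permMatrix_conj, Set.mem_ofPred_eq]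

theorem sum_vecMul_equiv {F : Type*} [Field F] [Fintype F] {δ : ℕ} {M : Type*} [AddCommMonoid M] (P : GL (Fin δ) F)
    (f : (Fin δ → F) → M) :
    ∑ z, f (z ᵥ* (P : Matrix (Fin δ) (Fin δ) F)) = ∑ z, f z :=
  Function.Bijective.sum_comp ⟨vecMul_injective_of_isUnit P.isUnit, vecMul_surjective_iff_isUnit.2 P.isUnit⟩ f

variable {p : ℕ} [Fact p.Prime] [Algebra (ZMod p) F] {ζ : ℂ}

/-- `Q` is the inverse transpose of `P`, so (xQ)·(zP) = x·z; reindexing both sums by `P` leaves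
every character value unchanged. -/
theorem macWilliamsConj_permute (hζ : IsPrimitiveRoot ζ p) (P Q : GL (Fin δ) F)
    (hPQ : (Q : Matrix (Fin δ) (Fin δ) F) * (P : Matrix (Fin δ) (Fin δ) F)ᵀ = 1)
    (L : Matrix (Fin δ → F) (Fin δ → F) ℂ[X]) :
    macWilliamsConj p ζ (permute (P : Matrix (Fin δ) (Fin δ) F) L) =
      permute (Q : Matrix (Fin δ) (Fin δ) F) (macWilliamsConj p ζ L) := by
  have hdot : ∀ x z : Fin δ → F, (x ᵥ* (Q : Matrix (Fin δ) (Fin δ) F)) ⬝ᵥ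
      (z ᵥ* (P : Matrix (Fin δ) (Fin δ) F)) = x ⬝ᵥ z := fun x z => by
    rw [← mulVec_transpose (P : Matrix (Fin δ) (Fin δ) F), dotProduct_mulVec, vecMul_vecMul, hPQ,
      vecMul_one]
  ext1 x y
  rw [permute.eq_def (Q : Matrix (Fin δ) (Fin δ) F), Matrix.submatrix_apply,
    macWilliamsConj_apply hζ, macWilliamsConj_apply hζ]
  conv_rhs => rw [← sum_vecMul_equiv P]
  refine Finset.sum_congr rfl fun z _ => ?_
  conv_rhs => rw [← sum_vecMul_equiv P]
  refine Finset.sum_congr rfl fun z' _ => ?_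
  rw [hdot, dotProduct_comm (z ᵥ* _), hdot, dotProduct_comm y]
  rfl

theorem macWilliamsDual_permute (hζ : IsPrimitiveRoot ζ p) (n k : ℕ) (P Q : GL (Fin δ) F)
    (hPQ : (Q : Matrix (Fin δ) (Fin δ) F) * (P : Matrix (Fin δ) (Fin δ) F)ᵀ = 1)
    (L : Matrix (Fin δ → F) (Fin δ → F) ℂ[X]) :
    macWilliamsDual p ζ n k (permute (P : Matrix (Fin δ) (Fin δ) F) L) =
      permute (Q : Matrix (Fin δ) (Fin δ) F) (macWilliamsDual p ζ n k L) := by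
  rw [macWilliamsDual, macWilliamsConj_permute hζ P Q hPQ]
  rfl

end Permutations

/-! ### Duality of the two systems -/

section MacWilliamsDuality

variable {F : Type*} [Field F] {k k' n δ : ℕ}

theorem mul_transpose_eq_zero_of_dual {G : Matrix (Fin k) (Fin n) F[X]}
    {H : Matrix (Fin k') (Fin n) F[X]} (h : rowImage H = dualCode (rowImage G)) :
    H * Gᵀ = 0 := by
  have hrow : ∀ {m : ℕ} (M : Matrix (Fin m) (Fin n) F[X]) (i : Fin m), M i ∈ rowImage M :=
    fun M i => ⟨Pi.single i 1, by simp [Matrix.row_def]⟩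
  ext1 a b
  exact (h ▸ hrow H a : H a ∈ dualCode (rowImage G)) (G b) (hrow G b)

theorem IsBasic.vecMul_coeffMatrix_injective {G : Matrix (Fin k) (Fin n) F[X]} (h : IsBasic G)
    {u : Fin k → F} (hu : u ᵥ* coeffMatrix G 0 = 0) : u = 0 := by
  obtain ⟨E₁, hE₁⟩ := h.coeffMatrix_zero
  rw [← vecMul_one u, ← hE₁, ← vecMul_vecMul, hu, zero_vecMul]

theorem IsBasic.le {G : Matrix (Fin k) (Fin n) F[X]} (h : IsBasic G) : k ≤ n := by
  have hinj : Function.Injective (coeffMatrix G 0).vecMulLinear := by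
    rw [← LinearMap.ker_eq_bot, LinearMap.ker_eq_bot']
    exact fun v hv => h.vecMul_coeffMatrix_injective hv
  simpa using LinearMap.finrank_le_finrank_of_injective hinj

variable {G : Matrix (Fin k) (Fin n) F[X]} {H : Matrix (Fin k') (Fin n) F[X]}
  (hGδ : ∑ i, rowDegree G i = δ) (hHδ : ∑ i, rowDegree H i = δ)

theorem isUnit_matrixP (hn : k + k' = n) (hG : IsBasic G) (hH : IsBasic H) (hHG : H * Gᵀ = 0)
    (hred : maxMinorDegree H = ∑ i, rowDegree H i) :
    IsUnit (matrixP (ccf G hGδ) (ccf H hHδ)) := by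
  rw [← vecMul_injective_iff_isUnit, matrixP_eq_reindex _ _ hHG]
  refine (injective_iff_map_eq_zero
    (Matrix.vecMulLinear (Matrix.reindex (blockEquiv hHδ) (blockEquiv hGδ)
      (bezoutMatrix H G)))).2 fun v hv => ?_
  have h0 : (v ∘ blockEquiv hHδ) ᵥ* bezoutMatrix H G = 0 := by
    ext y
    have := congrFun hv (blockEquiv hGδ y)
    refine Eq.trans ?_ this
    rw [vecMulLinear_apply, vecMul, vecMul, dotProduct, dotProduct, ← (blockEquiv hHδ).sum_comp]
    simp
  have h1 := bezoutMatrix_vecMul_injective hn hH hG hHG hred h0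
  ext i
  obtain ⟨x, rfl⟩ := (blockEquiv hHδ).surjective i
  exact congrFun h1 x

/-- The transitions of the dual system are the triples annihilated by the original system. -/
theorem annihilates_iff_exists_input (hn : k + k' = n) (hG : IsBasic G) (hH : IsBasic H)
    (hHG : H * Gᵀ = 0) (hP : IsUnit (matrixP (ccf G hGδ) (ccf H hHδ)))
    (x y : Fin δ → F) (w : Fin n → F) :
    ((ccf G hGδ).A *ᵥ (x ᵥ* matrixP (ccf G hGδ) (ccf H hHδ)) -
        y ᵥ* matrixP (ccf G hGδ) (ccf H hHδ) - (ccf G hGδ).C *ᵥ w = 0 ∧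
      (ccf G hGδ).B *ᵥ (x ᵥ* matrixP (ccf G hGδ) (ccf H hHδ)) - (ccf G hGδ).E *ᵥ w = 0) ↔
    ∃ u, y = x ᵥ* (ccf H hHδ).A + u ᵥ* (ccf H hHδ).B ∧
      x ᵥ* (ccf H hHδ).C + u ᵥ* (ccf H hHδ).E = w := by
  have hPA := matrixP_mul_transpose_A hGδ hHδ hHG
  have hPB := matrixP_mul_transpose_B hGδ hHδ hHG
  have hBP := B_mul_matrixP hGδ hHδ hHG
  have hEE := E_mul_transpose_E hGδ hHδ hHG
  obtain ⟨E₁, hE₁⟩ := hG.coeffMatrix_zero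
  obtain ⟨E₂, hE₂⟩ := hH.coeffMatrix_zero
  rw [← ccf_E_eq G hGδ] at hE₁
  rw [← ccf_E_eq H hHδ] at hE₂
  generalize matrixP (ccf G hGδ) (ccf H hHδ) = P at *
  generalize ccf G hGδ = R at *
  generalize ccf H hHδ = R' at *
  have key : ∀ u, w = x ᵥ* R'.C + u ᵥ* R'.E →
      R.A *ᵥ (x ᵥ* P) - R.C *ᵥ w = (x ᵥ* R'.A + u ᵥ* R'.B) ᵥ* P := by
    rintro u rfl
    rw [← vecMul_transpose R.A, ← vecMul_transpose R.C, vecMul_vecMul, hPA, add_vecMul, add_vecMul,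
      vecMul_vecMul, vecMul_vecMul, vecMul_vecMul, vecMul_vecMul, hBP, vecMul_add, vecMul_neg]
    abel
  have hB : R.B *ᵥ (x ᵥ* P) = (x ᵥ* R'.C) ᵥ* R.Eᵀ := by
    rw [← vecMul_transpose, vecMul_vecMul, hPB, vecMul_vecMul]
  constructor
  · rintro ⟨h1, h2⟩
    -- The second equation says that `w - x Ĉ` is orthogonal to the rows of `E`; exactness at D = 0
    -- produces the input `u`. The first equation then determines `y ᵥ* P`, hence `y`.
    obtain ⟨u, hu⟩ := exists_vecMul_eq_of_orthogonal (w := w - x ᵥ* R'.C)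
      ((finCongr (by omega)).trans finSumFinEquiv.symm : Fin n ≃ Fin k' ⊕ Fin k) hE₂ hE₁
      (by simpa using congrArg Matrix.transpose hEE)
      (by rw [sub_vecMul, ← hB, vecMul_transpose, ← neg_sub, h2, neg_zero])
    have hw := sub_eq_iff_eq_add'.1 hu
    refine ⟨u, vecMul_injective_of_isUnit hP ?_, hw.symm⟩
    rw [sub_right_comm, key u hw, sub_eq_zero] at h1
    exact h1.symm
  · rintro ⟨u, rfl, hw⟩
    rw [sub_right_comm, key u hw.symm, sub_self, hB, ← hw, ← vecMul_transpose R.E, add_vecMul,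
      vecMul_vecMul u, hEE, vecMul_zero, add_zero, sub_self]
    exact ⟨rfl, rfl⟩

theorem wam_dual_apply [Fintype F] [DecidableEq F] {p : ℕ} [Fact p.Prime] [Algebra (ZMod p) F]
    {ζ : ℂ} (hζ : IsPrimitiveRoot ζ p) (hn : k + k' = n) (hG : IsBasic G) (hH : IsBasic H)
    (hHG : H * Gᵀ = 0) (hP : IsUnit (matrixP (ccf G hGδ) (ccf H hHδ))) (x y : Fin δ → F) :
    wam (ccf H hHδ) x y = Polynomial.C (((Fintype.card F : ℂ) ^ k)⁻¹) *
      macWilliamsTransform (Fintype.card F) n (macWilliamsConj p ζ (wam (ccf G hGδ))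
        (x ᵥ* matrixP (ccf G hGδ) (ccf H hHδ)) (y ᵥ* matrixP (ccf G hGδ) (ccf H hHδ))) := by
  rw [macWilliams_wam hζ _ fun u hu => hG.vecMul_coeffMatrix_injective hu, ← Finset.sum_filter, wam,
    Matrix.of_apply, weightEnum_eq_sum]
  refine Finset.sum_congr ?_ fun _ _ => rfl
  ext w
  simp only [annihilates_iff_exists_input hGδ hHδ hn hG hH hHG hP, Finset.mem_image,
    Finset.mem_filter, Finset.mem_univ, true_and]

theorem exists_mul_transpose_eq_one (Q : GL (Fin δ) F) : ∃ T : GL (Fin δ) F,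
    (Q : Matrix (Fin δ) (Fin δ) F) * (T : Matrix (Fin δ) (Fin δ) F)ᵀ = 1 ∧
      (T : Matrix (Fin δ) (Fin δ) F) * (Q : Matrix (Fin δ) (Fin δ) F)ᵀ = 1 := by
  have h1 : ((Q⁻¹ : GL (Fin δ) F) : Matrix (Fin δ) (Fin δ) F)ᵀ *
      (Q : Matrix (Fin δ) (Fin δ) F)ᵀ = 1 := by
    rw [← transpose_mul, Units.mul_inv, transpose_one]
  have h2 : (Q : Matrix (Fin δ) (Fin δ) F)ᵀ *
      ((Q⁻¹ : GL (Fin δ) F) : Matrix (Fin δ) (Fin δ) F)ᵀ = 1 := by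
    rw [← transpose_mul, Units.inv_mul, transpose_one]
  exact ⟨⟨_, _, h1, h2⟩, by rw [transpose_transpose, Units.mul_inv], h1⟩

/-- The transform turns the action of `T` into that of its inverse transpose, so it maps orbits onto
orbits; the extra `P` only moves the base point. -/
theorem generalizedWam_permute [Fintype F] [DecidableEq F] {p : ℕ} [Fact p.Prime]
    [Algebra (ZMod p) F] {ζ : ℂ} (hζ : IsPrimitiveRoot ζ p)
    {L L' : Matrix (Fin δ → F) (Fin δ → F) ℂ[X]} (P : GL (Fin δ) F)
    (hL : L' = permute (P : Matrix (Fin δ) (Fin δ) F) (macWilliamsDual p ζ n k L)) :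
    generalizedWam L' = macWilliamsDual p ζ n k '' generalizedWam L := by
  ext M
  simp only [Set.mem_image, mem_generalizedWam, hL, permute_permute]
  constructor
  · rintro ⟨Q, rfl⟩
    obtain ⟨T, hT, -⟩ := exists_mul_transpose_eq_one (Q * P)
    exact ⟨_, ⟨T, rfl⟩, macWilliamsDual_permute hζ n k T (Q * P) hT L⟩
  · rintro ⟨_, ⟨T, rfl⟩, rfl⟩
    obtain ⟨Q, -, hQ⟩ := exists_mul_transpose_eq_one T
    refine ⟨Q * P⁻¹, ?_⟩
    rw [macWilliamsDual_permute hζ n k T Q hQ, ← Units.val_mul, inv_mul_cancel_right]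

end MacWilliamsDuality

end ConvCode

theorem theorem3p4 {F : Type*} [Field F] [Fintype F] [DecidableEq F]
    (p : ℕ) [Fact p.Prime] [Algebra (ZMod p) F] (ζ : ℂ) (hζ : IsPrimitiveRoot ζ p)
    {n k δ δ' : ℕ} (𝒞 : Submodule F[X] (Fin n → F[X]))
    (G : Matrix (Fin k) (Fin n) F[X]) (hG : IsMinimalEncoder G 𝒞 δ)
    (G' : Matrix (Fin (n - k)) (Fin n) F[X]) (hG' : IsMinimalEncoder G' (dualCode 𝒞) δ') :
    ∃ hδ : δ' = δ,
      let R : StateSpace F δ k n := ccf G hG.minimal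
      let R' : StateSpace F δ (n - k) n := ccf G' (hG'.minimal.trans hδ)
      (∃ P : GL (Fin δ) F, (P : Matrix (Fin δ) (Fin δ) F) = matrixP R R' ∧
        ∀ x y : Fin δ → F,
          wam R' x y = Polynomial.C (((Fintype.card F : ℂ) ^ k)⁻¹) *
            macWilliamsTransform (Fintype.card F) n
              (macWilliamsConj p ζ (wam R)
                (x ᵥ* (P : Matrix (Fin δ) (Fin δ) F)) (y ᵥ* (P : Matrix (Fin δ) (Fin δ) F)))) ∧
      generalizedWam (wam R') = macWilliamsDual p ζ n k '' generalizedWam (wam R) ∧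
      macWilliamsDual p ζ n k (wam R) ∈ generalizedWam (wam R') := by
  have hdual : rowImage G' = dualCode (rowImage G) := by rw [hG.image, hG'.image]
  have hHG := mul_transpose_eq_zero_of_dual hdual
  have hGH : G * G'ᵀ = 0 := by simpa using congrArg Matrix.transpose hHG
  have hn : k + (n - k) = n := Nat.add_sub_cancel' hG.basic.le
  have hredG : maxMinorDegree G = ∑ i, rowDegree G i := hG.degree.trans hG.minimal.symm
  have hredG' : maxMinorDegree G' = ∑ i, rowDegree G' i := hG'.degree.trans hG'.minimal.symm
  have hδ : δ' = δ := by
    have h1 := sum_rowDegree_le hn hG'.basic hG.basic hHG hredG'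
    have h2 := sum_rowDegree_le ((add_comm _ _).trans hn) hG.basic hG'.basic hGH hredG
    rw [hG.minimal, hG'.minimal] at h1 h2
    exact le_antisymm h1 h2
  refine ⟨hδ, ?_⟩
  obtain ⟨P, hP⟩ := isUnit_matrixP hG.minimal (hG'.minimal.trans hδ) hn hG.basic hG'.basic hHG
    hredG'
  have hwam := wam_dual_apply hG.minimal (hG'.minimal.trans hδ) hζ hn hG.basic hG'.basic hHG
    (hP ▸ P.isUnit)
  rw [← hP] at hwam
  have hpermute : wam (ccf G' (hG'.minimal.trans hδ)) =
      permute (P : Matrix (Fin δ) (Fin δ) F) (macWilliamsDual p ζ n k (wam (ccf G hG.minimal))) :=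
    Matrix.ext hwam
  refine ⟨⟨P, hP, hwam⟩, generalizedWam_permute hζ P hpermute, ?_⟩
  rw [mem_generalizedWam]
  refine ⟨P⁻¹, ?_⟩
  rw [hpermute, permute_permute, Units.inv_mul]
  ext1 x y
  simp [permute]
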